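/- \textbf{Lemma (Bound on Rademacher Complexity).} Let $\|\cdot\|$ denote Euclidean norms. Let $\mathcal D\subset\mathbb R^m$, let $C_\Phi,C_\Psi,C_{{\rm out},T},C_{\rm out}>0$, let $\Phi=\{\phi\in\mathbb R^{p_\Phi}:\|\phi\|\le C_\Phi\}$, $\Psi=\{\psi\in\mathbb R^{p_\Psi}:\|\psi\|\le C_\Psi\}$ and $\Theta=\Phi\times\Psi$, and let $T_\psi(x;d)\in\mathbb R^k$ and $P_\phi(x)\in\mathbb R^n$ be given for $\psi\in\mathbb R^{p_\Psi}$, $\phi\in\mathbb R^{p_\Phi}$, $x\in\mathbb R^k$, $d\in\mathbb R^m$. Assume: \begin{enumerate} \item (Lipschitz loss) $\ell:\mathbb R^n\times\mathbb R^n\to\mathbb R$ is Lipschitz with constant $L_\ell$. \item (Contractivity, Lipschitz properties) There is $L_x\in(0,1)$ such that for all $\psi\in\Psi$, $d\in\mathcal D$ the map $x\mapsto T_\psi(x;d)$ is Lipschitz on $\mathbb R^k$ with constant $L_x$; let $x^\star_{\psi,d}$ be its unique fixed point (for $d\notin\mathcal D$, let $x^\star_{\psi,d}$ be any fixed point of $T_\psi(\cdot\,;d)$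 if one exists, and $0$ otherwise; this choice is immaterial below), and let $\mathcal X^\star=\{x^\star_{\psi,d}:\psi\in\Psi,\ d\in\mathcal D\}$. For all $x\in\mathcal X^\star$, $d\in\mathcal D$ the map $\psi\mapsto T_\psi(x;d)$ is Lipschitz on $\Psi$ with constant $L_\psi$. On $\Phi\times\{x\in\mathbb R^k:\|x\|\le C_{{\rm out},T}\}$ the map $(\phi,x)\mapsto P_\phi(x)$ is Lipschitz in $\phi$ with constant $L_{P,\phi}$ and Lipschitz in $x$ with constant $L_{P,x}$. \item (Boundedness) $\|x^\star_{\psi,d}\|\le C_{{\rm out},T}$ and $\|P_\phi(x^\star_{\psi,d})\|\le C_{\rm out}$ for all $(\phi,\psi)\in\Theta$, $d\in\mathcal D$. \end{enumerate} Let $\mathcal H$ be the set of the functions $d\mapsto P_\phi(x^\star_{\psi,d})$, $(\phi,\psi)\in\Theta$, and let $\ell\circ\mathcal H=\{(d,y)\mapsto\ell(h(d),y):h\in\mathcal H\}$. Let $N\ge1$, let $S=((d_i,y_i))_{i=1}^N$ be a sample with $d_i\in\mathcal D$, $y_i\in\mathbb R^n$, and let $$\mathcal R_S(\ell\circ\mathcal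 H)=\mathbb E_\epsilon\sup_{h\in\mathcal H}\frac1N\sum_{i=1}^N\epsilon_i\,\ell(h(d_i),y_i),$$ where $\epsilon$ is uniformly distributed on $\{-1,1\}^N$. Let $$\mathcal M=\big\{[P_\phi(x^\star_{\psi,d_1}),\dots,P_\phi(x^\star_{\psi,d_N})]\in\mathbb R^{n\times N}:(\phi,\psi)\in\Theta\big\}$$ be the set of stacked network outputs, with the Euclidean (Frobenius) norm, and for $r>0$ let $\mathcal N(\mathcal M,\|\cdot\|,r)$ be the smallest number of open balls of radius $r$ with centers in $\mathcal M$ that cover $\mathcal M$. Then the suprema in $\mathcal R_S(\ell\circ\mathcal H)$ are finite, the integral below converges, and $$\mathcal R_S(\ell\circ\mathcal H)\le\frac{8L_\ell}{N}\int_0^{\sqrt N\,C_{\rm out}/2}\sqrt{\log\mathcal N(\mathcal M,\|\cdot\|,r)}\;dr.$$ -/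

import Mathlib

open scoped NNReal

namespace ImplicitNet

/-- `E q` is `ℝ^q` with its Euclidean norm. -/
abbrev E (q : ℕ) : Type := EuclideanSpace ℝ (Fin q)

/-! ### Covering numbers -/

/-- The finite set `s` of centres, taken in `A`, gives a cover of `A` by (open) balls of
radius `r`. -/
def IsBallCover {X : Type*} [PseudoMetricSpace X] (A : Set X) (r : ℝ) (s : Finset X) : Prop :=
  (s : Set X) ⊆ A ∧ A ⊆ ⋃ x ∈ s, Metric.ball x r

/-- The covering number of the metric space `A` (with the metric inherited from `X`) at level `r`:
the smallest number of balls of `A` of radius `r` that cover `A`. It is used for totally bounded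
`A` and `r > 0` only, where such a finite cover exists (`exists_isBallCover`). -/
noncomputable def coveringNumber {X : Type*} [PseudoMetricSpace X] (A : Set X) (r : ℝ) : ℕ :=
  sInf {n : ℕ | ∃ s : Finset X, IsBallCover A r s ∧ s.card = n}

theorem exists_isBallCover {X : Type*} [PseudoMetricSpace X] {A : Set X}
    (hA : TotallyBounded A) {r : ℝ} (hr : 0 < r) : ∃ s : Finset X, IsBallCover A r s := by
  obtain ⟨t, htA, htf, hcov⟩ := (totallyBounded_iff_subset.1 hA) _ (Metric.dist_mem_uniformity hr)
  refine ⟨htf.toFinset, by simpa using htA, ?_⟩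
  intro x hx
  obtain ⟨y, hy, hxy⟩ := Set.mem_iUnion₂.1 (hcov hx)
  exact Set.mem_iUnion₂.2 ⟨y, by simpa using hy, hxy⟩

/-! ### Empirical Rademacher complexity -/

/-- The values `(1/N) ∑ᵢ εᵢ g(zᵢ)`, `g ∈ G`, for a fixed sign vector `ε ∈ {-1, 1}^N`. -/
def signedMeans {Z : Type*} {N : ℕ} (G : Set (Z → ℝ)) (z : Fin N → Z) (ε : Fin N → ℤˣ) : Set ℝ :=
  (fun g : Z → ℝ => (1 / (N : ℝ)) * ∑ i, ((ε i : ℤ) : ℝ) * g (z i)) '' G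

/-- The empirical Rademacher complexity of `G` on the sample `z`: the expectation of
`sup_{g ∈ G} (1/N) ∑ᵢ εᵢ g(zᵢ)` over a Rademacher vector `ε`, that is, the average over the
`2 ^ N` equally likely sign vectors. -/
noncomputable def rademacherComplexity {Z : Type*} {N : ℕ} (G : Set (Z → ℝ)) (z : Fin N → Z) : ℝ :=
  (1 / (2 : ℝ) ^ N) * ∑ ε : Fin N → ℤˣ, sSup (signedMeans G z ε)

/-! ### Implicit networks -/

open Classical in
/-- The fixed point `x⋆_{ψ,d}` of `T_ψ(· ; d)` (and `0` if there is none; for `T_ψ(· ; d)`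
contractive, there is exactly one). -/
noncomputable def fixedPt {pΨ k m : ℕ} (T : E pΨ → E k → E m → E k) (ψ : E pΨ) (d : E m) : E k :=
  if h : ∃ x : E k, T ψ x d = x then h.choose else 0

/-- The output `P_φ(x⋆_{ψ,d})` of the implicit network with parameters `(φ, ψ)` on input `d`. -/
noncomputable def networkOutput {pΦ pΨ k m n : ℕ} (T : E pΨ → E k → E m → E k)
    (P : E pΦ → E k → E n) (φ : E pΦ) (ψ : E pΨ) (d : E m) : E n :=
  P φ (fixedPt T ψ d)

/-- The parameter set `Θ = Φ × Ψ`, a product of two closed balls. -/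
def paramSet (pΦ pΨ : ℕ) (CΦ CΨ : ℝ) : Set (E pΦ × E pΨ) :=
  {θ | ‖θ.1‖ ≤ CΦ ∧ ‖θ.2‖ ≤ CΨ}

/-- The class `ℋ` of the hypothesis functions `d ↦ P_φ(x⋆_{ψ,d})`, `(φ, ψ) ∈ Θ`. -/
def hypothesisClass {pΦ pΨ k m n : ℕ} (T : E pΨ → E k → E m → E k) (P : E pΦ → E k → E n)
    (CΦ CΨ : ℝ) : Set (E m → E n) :=
  {h | ∃ θ ∈ paramSet pΦ pΨ CΦ CΨ, ∀ d, h d = networkOutput T P θ.1 θ.2 d}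

/-- The class `ℓ ∘ ℋ` of the functions `(d, y) ↦ ℓ(h(d), y)`, `h ∈ ℋ`. -/
def lossClass {m n : ℕ} (ℓ : E n → E n → ℝ) (H : Set (E m → E n)) : Set (E m × E n → ℝ) :=
  {g | ∃ h ∈ H, ∀ z, g z = ℓ (h z.1) z.2}

/-- The set `ℳ ⊆ ℝ^{n × N}` of the stacked network outputs on `d₁, …, d_N`. A matrix is given by
its `N` columns, and the norm is the Euclidean (Frobenius) norm. -/
def stackedOutputs {pΦ pΨ k m n N : ℕ} (T : E pΨ → E k → E m → E k) (P : E pΦ → E k → E n)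
    (CΦ CΨ : ℝ) (d : Fin N → E m) : Set (PiLp 2 (fun _ : Fin N => E n)) :=
  {M | ∃ θ ∈ paramSet pΦ pΨ CΦ CΨ, ∀ i, M i = networkOutput T P θ.1 θ.2 (d i)}

/-- The set `𝒳⋆ = {x⋆_{ψ,d} : d ∈ 𝒟, ψ ∈ Ψ}` of all possible fixed points. -/
def fixedPtSet {pΨ k m : ℕ} (T : E pΨ → E k → E m → E k) (CΨ : ℝ) (D : Set (E m)) : Set (E k) :=
  {x | ∃ d ∈ D, ∃ ψ : E pΨ, ‖ψ‖ ≤ CΨ ∧ x = fixedPt T ψ d}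

/-- The loss `ℓ : ℝⁿ × ℝⁿ → ℝ` is Lipschitz with constant `L`, for the Euclidean norm of
`ℝⁿ × ℝⁿ`. -/
def LipschitzLoss {n : ℕ} (ℓ : E n → E n → ℝ) (L : ℝ≥0) : Prop :=
  LipschitzWith L (fun z : WithLp 2 (E n × E n) => ℓ z.fst z.snd)

/-- Bounded network parameters, fixed points and outputs. -/
structure BoundedNetwork {pΦ pΨ k m n : ℕ} (T : E pΨ → E k → E m → E k) (P : E pΦ → E k → E n)
    (D : Set (E m)) (CΦ CΨ CoutT Cout : ℝ) : Prop where
  CΦ_pos : 0 < CΦ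
  CΨ_pos : 0 < CΨ
  CoutT_pos : 0 < CoutT
  Cout_pos : 0 < Cout
  norm_fixedPt_le : ∀ θ ∈ paramSet pΦ pΨ CΦ CΨ, ∀ d ∈ D, ‖fixedPt T θ.2 d‖ ≤ CoutT
  norm_output_le : ∀ θ ∈ paramSet pΦ pΨ CΦ CΨ, ∀ d ∈ D, ‖networkOutput T P θ.1 θ.2 d‖ ≤ Cout

/-- `T_ψ(x ; d)` is contractive in `x`, and Lipschitz in `ψ` at the fixed points; the final layer
`P_φ(x)` is Lipschitz in `φ` and in `x` on `Φ` times the closed ball of radius `CoutT`. -/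
structure LipschitzNetwork {pΦ pΨ k m n : ℕ} (T : E pΨ → E k → E m → E k) (P : E pΦ → E k → E n)
    (D : Set (E m)) (CΦ CΨ CoutT : ℝ) (Lx Lψ LPφ LPx : ℝ≥0) : Prop where
  Lx_pos : 0 < Lx
  Lx_lt_one : Lx < 1
  contractive : ∀ ψ : E pΨ, ‖ψ‖ ≤ CΨ → ∀ d ∈ D, LipschitzWith Lx (fun x => T ψ x d)
  lipschitz_param : ∀ x ∈ fixedPtSet T CΨ D, ∀ d ∈ D,
    LipschitzOnWith Lψ (fun ψ => T ψ x d) {ψ | ‖ψ‖ ≤ CΨ}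
  layer_lipschitz_param : ∀ x ∈ Metric.closedBall (0 : E k) CoutT,
    LipschitzOnWith LPφ (fun φ => P φ x) {φ | ‖φ‖ ≤ CΦ}
  layer_lipschitz_input : ∀ φ : E pΦ, ‖φ‖ ≤ CΦ →
    LipschitzOnWith LPx (P φ) (Metric.closedBall (0 : E k) CoutT)

end ImplicitNet

open ImplicitNet

/-! The proof is Dudley's chaining. On a fixed sample the loss class matters only through its
vectors of losses (`signedMeans_lossClass`), and these are an `Lℓ`-Lipschitz image of the stacked
outputs, so the entropy of the outputs themselves controls the Rademacher process. The outputs lie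
in a ball of radius `R = √N * Cout` about `0`. Approximate each of them along nets at scales `R / 2
^ j`, starting from `0`. A link from scale `R / 2 ^ j` has length at most `R / 2 ^ j`, so Massart's
lemma `expect_sup'_signedSum_le` bounds the mean of the largest increment by `Lℓ * (R / 2 ^ j)`
times `√(2 log)` of the size of the finer net. `expect_sup'_chain_le` adds these up, and
`sum_mul_le_integral_of_antitoneOn` compares the sum with the integral. The constant is `4√2 ≤ 8`.
The integral converges because finite dimension makes the integrand `O(r ^ (-1/2))` near `0`. -/

namespace ImplicitNet

open scoped BigOperators Pointwise

/-! ### Rademacher sums, finite maxima and chaining -/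

/-- The signed sum `∑ᵢ εᵢ vᵢ`. -/
noncomputable def signedSum {N : ℕ} (ε : Fin N → ℤˣ) (v : E N) : ℝ :=
  ∑ i, ((ε i : ℤ) : ℝ) * v i

theorem signedSum_add {N : ℕ} (ε : Fin N → ℤˣ) (v w : E N) :
    signedSum ε (v + w) = signedSum ε v + signedSum ε w := by
  simp [signedSum, mul_add, Finset.sum_add_distrib]

theorem signedSum_sub {N : ℕ} (ε : Fin N → ℤˣ) (v w : E N) :
    signedSum ε (v - w) = signedSum ε v - signedSum ε w := by
  simp [signedSum, mul_sub, Finset.sum_sub_distrib]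

theorem signedSum_smul {N : ℕ} (ε : Fin N → ℤˣ) (c : ℝ) (v : E N) :
    signedSum ε (c • v) = c * signedSum ε v := by
  simp only [signedSum, PiLp.smul_apply, smul_eq_mul, Finset.mul_sum]
  exact Finset.sum_congr rfl fun i _ => by ring

theorem signedSum_le {N : ℕ} (ε : Fin N → ℤˣ) (v : E N) :
    signedSum ε v ≤ √(N : ℝ) * ‖v‖ := by
  have h := Finset.sum_mul_sq_le_sq_mul_sq Finset.univ (fun i => ((ε i : ℤ) : ℝ)) (fun i => v i)
  have h1 : ∀ i, (((ε i : ℤ) : ℝ)) ^ 2 = 1 := fun i => by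
    rcases Int.units_eq_one_or (ε i) with h | h <;> simp [h]
  simp only [h1, Finset.sum_const, Finset.card_univ, Fintype.card_fin, nsmul_eq_mul, mul_one,
    ← EuclideanSpace.real_norm_sq_eq] at h
  refine le_of_sq_le_sq ?_ (by positivity)
  rwa [mul_pow, Real.sq_sqrt (Nat.cast_nonneg N)]

/-- Independence of the signs factors the mean into `∏ cosh (v i)`, and `cosh t ≤ exp (t² / 2)`. -/
theorem expect_exp_signedSum_le {N : ℕ} (v : E N) :
    𝔼 ε : Fin N → ℤˣ, Real.exp (signedSum ε v) ≤ Real.exp (‖v‖ ^ 2 / 2) := by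
  have hprod : ∑ ε : Fin N → ℤˣ, Real.exp (signedSum ε v)
      = ∏ i : Fin N, (2 * Real.cosh (v i)) := by
    have h2 : ∀ i, 2 * Real.cosh (v i) = ∑ u : ℤˣ, Real.exp (((u : ℤ) : ℝ) * v i) := fun i => by
      rw [UnitsInt.univ, Finset.sum_pair (by decide), Real.cosh_eq]
      push_cast
      simp only [one_mul, neg_mul]
      ring
    simp only [h2, Finset.prod_univ_sum, Fintype.piFinset_univ, signedSum, Real.exp_sum]
  rw [Fintype.expect_eq_sum_div_card, hprod, Finset.prod_mul_distrib]
  have hcard : (Fintype.card (Fin N → ℤˣ) : ℝ) = 2 ^ N := by simp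
  simp only [hcard, Finset.prod_const, Finset.card_univ, Fintype.card_fin]
  rw [mul_div_cancel_left₀ _ (by positivity), EuclideanSpace.real_norm_sq_eq, Finset.sum_div,
    Real.exp_sum]
  exact Finset.prod_le_prod (fun i _ => (Real.cosh_pos _).le)
    fun i _ => Real.cosh_le_exp_half_sq _

theorem le_mul_sqrt_of_forall_mul_le {x ρ c : ℝ} (hρ : 0 ≤ ρ) (hc : 0 ≤ c)
    (h : ∀ t : ℝ, 0 < t → t * x ≤ c + t ^ 2 * ρ ^ 2 / 2) : x ≤ ρ * √(2 * c) := by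
  rcases le_or_gt x 0 with hx | hx
  · exact hx.trans (by positivity)
  rcases hρ.eq_or_lt with rfl | hρ
  · have := h ((c + 1) / x) (by positivity)
    rw [div_mul_cancel₀ _ hx.ne'] at this
    linarith
  · have := h (x / ρ ^ 2) (by positivity)
    have h1 : (x / ρ ^ 2) ^ 2 * ρ ^ 2 / 2 = x ^ 2 / ρ ^ 2 / 2 := by field_simp
    have h2 : x / ρ ^ 2 * x = x ^ 2 / ρ ^ 2 := by ring
    rw [h1, h2] at this
    have h3 : x ^ 2 / ρ ^ 2 ≤ 2 * c := by linarith
    rw [div_le_iff₀ (by positivity)] at h3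
    refine le_of_sq_le_sq ?_ (by positivity)
    rw [mul_pow, Real.sq_sqrt (by positivity)]
    linarith

/-- Massart's finite class lemma. -/
theorem expect_sup'_signedSum_le {N : ℕ} {ι : Type*} (s : Finset ι) (hs : s.Nonempty)
    (v : ι → E N) {ρ : ℝ} (hρ : 0 ≤ ρ) (hv : ∀ i ∈ s, ‖v i‖ ≤ ρ) :
    𝔼 ε : Fin N → ℤˣ, s.sup' hs (fun i => signedSum ε (v i))
      ≤ ρ * √(2 * Real.log (s.card : ℝ)) := by
  have hcard : (1 : ℝ) ≤ s.card := by exact_mod_cast hs.card_pos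
  refine le_mul_sqrt_of_forall_mul_le hρ (Real.log_nonneg hcard) fun t ht => ?_
  set c := Real.log (s.card : ℝ) + t ^ 2 * ρ ^ 2 / 2 with hc
  have hexpc : Real.exp c = s.card * Real.exp (t ^ 2 * ρ ^ 2 / 2) := by
    rw [hc, Real.exp_add, Real.exp_log (by linarith)]
  -- The tangent bound `u ≤ exp (u - c) + c - 1` replaces Jensen's inequality. With this `c` the
  -- quotient has mean at most `1`, so only `c` remains.
  have hpt : ∀ ε : Fin N → ℤˣ, t * s.sup' hs (fun i => signedSum ε (v i)) ≤
      (∑ i ∈ s, Real.exp (signedSum ε (t • v i))) / Real.exp c + (c - 1) := fun ε => by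
    obtain ⟨i, hi, hmax⟩ := Finset.exists_mem_eq_sup' hs (fun i => signedSum ε (v i))
    rw [hmax, ← signedSum_smul]
    have h1 := Real.add_one_le_exp (signedSum ε (t • v i) - c)
    rw [Real.exp_sub] at h1
    have h2 : Real.exp (signedSum ε (t • v i)) ≤ ∑ i ∈ s, Real.exp (signedSum ε (t • v i)) :=
      Finset.single_le_sum (f := fun i => Real.exp (signedSum ε (t • v i)))
        (fun _ _ => (Real.exp_pos _).le) hi
    have h3 := div_le_div_of_nonneg_right h2 (Real.exp_pos c).le
    linarith
  have hsum : ∑ i ∈ s, 𝔼 ε : Fin N → ℤˣ, Real.exp (signedSum ε (t • v i)) ≤ Real.exp c := by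
    rw [hexpc, ← nsmul_eq_mul]
    refine Finset.sum_le_card_nsmul _ _ _ fun i hi => (expect_exp_signedSum_le _).trans ?_
    rw [norm_smul, mul_pow, Real.norm_eq_abs, sq_abs]
    have := hv i hi
    gcongr
  rw [Finset.mul_expect]
  refine (Finset.expect_le_expect fun ε _ => hpt ε).trans ?_
  rw [Finset.expect_add_distrib, Fintype.expect_const, ← Finset.expect_div,
    Finset.expect_sum_comm]
  have := (div_le_one (Real.exp_pos c)).2 hsum
  linarith

/-- Each link is determined by its finer endpoint once parents are chosen, so Massart's lemma counts
the points of one net, not pairs. -/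
theorem expect_sup'_chain_le {N : ℕ} {X : Type*} [PseudoMetricSpace X] {f : X → E N} {L : ℝ≥0}
    (hf : LipschitzWith L f) (s : ℕ → Finset X) (hs : ∀ j, (s j).Nonempty) {x₀ : X}
    (h0 : s 0 = {x₀}) {r : ℕ → ℝ} (hr : ∀ j, 0 ≤ r j)
    (hparent : ∀ j, ∀ x ∈ s (j + 1), ∃ y ∈ s j, dist x y ≤ r j) (K : ℕ) :
    𝔼 ε : Fin N → ℤˣ, (s K).sup' (hs K) (fun x => signedSum ε (f x - f x₀)) ≤
      ∑ j ∈ Finset.range K, L * r j * √(2 * Real.log ((s (j + 1)).card : ℝ)) := by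
  induction K with
  | zero => simp [h0, signedSum]
  | succ K ih =>
    have : ∀ x, ∃ y, x ∈ s (K + 1) → y ∈ s K ∧ dist x y ≤ r K := fun x => by
      by_cases hx : x ∈ s (K + 1)
      · obtain ⟨y, hy⟩ := hparent K x hx
        exact ⟨y, fun _ => hy⟩
      · exact ⟨x, fun h => absurd h hx⟩
    choose p hp using this
    rw [Finset.sum_range_succ]
    refine le_trans ?_ (add_le_add ih (expect_sup'_signedSum_le (s (K + 1)) (hs _)
      (fun x => f x - f (p x)) (mul_nonneg L.2 (hr K)) fun x hx => ?_))
    · rw [← Finset.expect_add_distrib]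
      refine Finset.expect_le_expect fun ε _ => Finset.sup'_le _ _ fun x hx => ?_
      have hsplit : f x - f x₀ = (f (p x) - f x₀) + (f x - f (p x)) := by abel
      rw [hsplit, signedSum_add]
      exact add_le_add
        (Finset.le_sup' (fun y => signedSum ε (f y - f x₀)) (hp x hx).1)
        (Finset.le_sup' (fun y => signedSum ε (f y - f (p y))) hx)
    · rw [← dist_eq_norm]
      exact (hf.dist_le_mul _ _).trans (mul_le_mul_of_nonneg_left (hp x hx).2 L.2)

/-! ### Covering numbers -/

section CoveringNumber
variable {X : Type*} [PseudoMetricSpace X] {A : Set X}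

theorem exists_isBallCover_card_eq_coveringNumber (hA : TotallyBounded A) {r : ℝ} (hr : 0 < r) :
    ∃ s : Finset X, IsBallCover A r s ∧ s.card = coveringNumber A r := by
  obtain ⟨s, hs⟩ := exists_isBallCover hA hr
  exact Nat.sInf_mem (s := {n : ℕ | ∃ s : Finset X, IsBallCover A r s ∧ s.card = n}) ⟨_, s, hs, rfl⟩

theorem IsBallCover.coveringNumber_le {r : ℝ} {s : Finset X} (hs : IsBallCover A r s) :
    coveringNumber A r ≤ s.card :=
  Nat.sInf_le ⟨s, hs, rfl⟩

theorem IsBallCover.nonempty {r : ℝ} {s : Finset X} (hs : IsBallCover A r s) (hA : A.Nonempty) :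
    s.Nonempty := by
  obtain ⟨x, hx⟩ := hA
  obtain ⟨y, hy, -⟩ := Set.mem_iUnion₂.1 (hs.2 hx)
  exact ⟨y, hy⟩

theorem coveringNumber_pos (hA : TotallyBounded A) (hne : A.Nonempty) {r : ℝ} (hr : 0 < r) :
    0 < coveringNumber A r := by
  obtain ⟨s, hs, hcard⟩ := exists_isBallCover_card_eq_coveringNumber hA hr
  rw [← hcard]
  exact (hs.nonempty hne).card_pos

theorem coveringNumber_anti (hA : TotallyBounded A) {r r' : ℝ} (hr : 0 < r) (h : r ≤ r') :
    coveringNumber A r' ≤ coveringNumber A r := by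
  obtain ⟨s, hs, hcard⟩ := exists_isBallCover_card_eq_coveringNumber hA hr
  rw [← hcard]
  exact IsBallCover.coveringNumber_le
    ⟨hs.1, hs.2.trans (Set.iUnion₂_mono fun x _ => Metric.ball_subset_ball h)⟩

theorem antitoneOn_sqrt_log_coveringNumber (hA : TotallyBounded A) (hne : A.Nonempty) :
    AntitoneOn (fun r : ℝ => √(Real.log (coveringNumber A r))) (Set.Ioi 0) := by
  intro r hr r' _ h
  have hr' : 0 < r' := lt_of_lt_of_le hr h
  refine Real.sqrt_le_sqrt (Real.log_le_log ?_ ?_)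
  · exact_mod_cast coveringNumber_pos hA hne hr'
  · exact_mod_cast coveringNumber_anti hA hr h

open Classical in
/-- An external cover by closed balls of radius `ρ` gives a cover with centres in the set, by open
balls of any radius greater than `2 ρ`. -/
theorem coveringNumber_le_of_subset_iUnion_closedBall {s : Finset X} {ρ r : ℝ} (hr : 2 * ρ < r)
    (hs : A ⊆ ⋃ x ∈ s, Metric.closedBall x ρ) : coveringNumber A r ≤ s.card := by
  have : ∀ x, ∃ y, (A ∩ Metric.closedBall x ρ).Nonempty → y ∈ A ∩ Metric.closedBall x ρ :=
    fun x => by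
      by_cases h : (A ∩ Metric.closedBall x ρ).Nonempty
      · exact ⟨h.some, fun _ => h.some_mem⟩
      · exact ⟨x, fun h' => absurd h' h⟩
  choose p hp using this
  have hcov : IsBallCover A r
      ((s.filter fun x => (A ∩ Metric.closedBall x ρ).Nonempty).image p) := by
    refine ⟨fun y hy => ?_, fun a ha => ?_⟩
    · simp only [Finset.coe_image, Set.mem_image, Finset.mem_coe, Finset.mem_filter] at hy
      obtain ⟨x, ⟨-, hx⟩, rfl⟩ := hy
      exact (hp x hx).1
    · obtain ⟨x, hx, hax⟩ := Set.mem_iUnion₂.1 (hs ha)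
      have hne : (A ∩ Metric.closedBall x ρ).Nonempty := ⟨a, ha, hax⟩
      refine Set.mem_iUnion₂.2 ⟨p x, Finset.mem_image_of_mem p (Finset.mem_filter.2 ⟨hx, hne⟩), ?_⟩
      have h1 := dist_triangle_right a (p x) x
      have h2 := Metric.mem_closedBall.1 (hp x hne).2
      have h3 := Metric.mem_closedBall.1 hax
      rw [Metric.mem_ball]
      linarith
  exact hcov.coveringNumber_le.trans (Finset.card_image_le.trans (Finset.card_filter_le _ _))

end CoveringNumber

/-! ### Entropy in finite dimension -/

section FiniteDimensional
variable {V : Type*} [NormedAddCommGroup V] [NormedSpace ℝ V] [FiniteDimensional ℝ V]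

-- By scaling, one cover of the unit ball by `K` balls of radius `1 / 2` refines every ball to half
-- its radius at the cost of a factor `K`; iterate.
variable (V) in
open Classical in
theorem exists_card_le_pow_closedBall_subset :
    ∃ K : ℕ, 0 < K ∧ ∀ R : ℝ, 0 < R → ∀ j : ℕ, ∃ s : Finset V, s.card ≤ K ^ j ∧
      Metric.closedBall (0 : V) R ⊆ ⋃ x ∈ s, Metric.closedBall x (R / 2 ^ j) := by
  have := FiniteDimensional.proper ℝ V
  obtain ⟨t, ht⟩ := exists_isBallCover (isCompact_closedBall (0 : V) 1).totallyBounded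
    (r := 1 / 2) (by norm_num)
  refine ⟨t.card, (ht.nonempty ⟨0, by simp⟩).card_pos, fun R hR j => ?_⟩
  induction j with
  | zero => exact ⟨{0}, by simp, by simp⟩
  | succ j ih =>
    obtain ⟨s, hcard, hs⟩ := ih
    have hδ : 0 < R / 2 ^ j := by positivity
    refine ⟨Finset.image₂ (fun x y => x + (R / 2 ^ j) • y) s t, ?_, fun a ha => ?_⟩
    · exact (Finset.card_image₂_le _ _ _).trans (by rw [pow_succ]; gcongr)
    · obtain ⟨x, hx, hax⟩ := Set.mem_iUnion₂.1 (hs ha)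
      rw [mem_closedBall_iff_norm] at hax
      have hmem : (R / 2 ^ j)⁻¹ • (a - x) ∈ Metric.closedBall (0 : V) 1 := by
        rw [mem_closedBall_zero_iff, norm_smul, norm_inv, Real.norm_of_nonneg hδ.le,
          inv_mul_le_iff₀ hδ, mul_one]
        exact hax
      obtain ⟨y, hy, hay⟩ := Set.mem_iUnion₂.1 (ht.2 hmem)
      refine Set.mem_iUnion₂.2 ⟨_, Finset.mem_image₂_of_mem hx hy, ?_⟩
      rw [mem_ball_iff_norm] at hay
      rw [mem_closedBall_iff_norm]
      have heq : a - (x + (R / 2 ^ j) • y) = (R / 2 ^ j) • ((R / 2 ^ j)⁻¹ • (a - x) - y) := by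
        rw [smul_sub, smul_inv_smul₀ hδ.ne']
        abel
      rw [heq, norm_smul, Real.norm_of_nonneg hδ.le, pow_succ, ← div_div, div_eq_mul_one_div _ 2]
      exact mul_le_mul_of_nonneg_left hay.le hδ.le

theorem exists_log_coveringNumber_le {A : Set V} {R : ℝ} (hR : 0 < R)
    (hA : A ⊆ Metric.closedBall 0 R) (hne : A.Nonempty) :
    ∃ c : ℝ, 0 ≤ c ∧ ∀ r : ℝ, 0 < r → Real.log (coveringNumber A r) ≤ (2 * R / r + 2) * c := by
  have := FiniteDimensional.proper ℝ V
  have htb : TotallyBounded A := (isCompact_closedBall (0 : V) R).totallyBounded.subset hA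
  obtain ⟨K, hK, hcov⟩ := exists_card_le_pow_closedBall_subset V
  have hlogK : 0 ≤ Real.log K := Real.log_natCast_nonneg K
  refine ⟨Real.log K, hlogK, fun r hr => ?_⟩
  -- About `log₂ (R / r)` halvings would do; a number linear in `R / r` follows from `j < 2 ^ j`,
  -- and its square root is still integrable at `0`.
  set j := ⌈2 * R / r⌉₊ + 1 with hj
  obtain ⟨s, hcard, hs⟩ := hcov R hR j
  have hj1 : 2 * R / r < 2 ^ j := by
    have h1 : (2 * R / r) ≤ ⌈2 * R / r⌉₊ := Nat.le_ceil _
    have h2 : ((j : ℕ) : ℝ) < 2 ^ j := by exact_mod_cast Nat.lt_two_pow_self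
    have h3 : (j : ℝ) = ⌈2 * R / r⌉₊ + 1 := by simp [hj]
    linarith
  have hj2 : (j : ℝ) ≤ 2 * R / r + 2 := by
    have h1 := (Nat.ceil_lt_add_one (show 0 ≤ 2 * R / r by positivity)).le
    have h3 : (j : ℝ) = ⌈2 * R / r⌉₊ + 1 := by simp [hj]
    linarith
  have hr2 : 2 * (R / 2 ^ j) < r := by
    rw [← mul_div_assoc, div_lt_iff₀ (by positivity)]
    rw [div_lt_iff₀ hr] at hj1
    linarith
  have hle : coveringNumber A r ≤ K ^ j :=
    (coveringNumber_le_of_subset_iUnion_closedBall hr2 (hA.trans hs)).trans hcard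
  calc Real.log (coveringNumber A r) ≤ Real.log ((K : ℝ) ^ j) := by
        refine Real.log_le_log ?_ (by exact_mod_cast hle)
        exact_mod_cast coveringNumber_pos htb hne hr
    _ = j * Real.log K := Real.log_pow _ _
    _ ≤ _ := mul_le_mul_of_nonneg_right hj2 hlogK

theorem intervalIntegrable_sqrt_log_coveringNumber {A : Set V} {R : ℝ}
    (hA : A ⊆ Metric.closedBall 0 R) (hne : A.Nonempty) (hR : 0 < R) {b : ℝ} (hb : 0 ≤ b) :
    IntervalIntegrable (fun r : ℝ => √(Real.log (coveringNumber A r)))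
      MeasureTheory.volume 0 b := by
  have := FiniteDimensional.proper ℝ V
  have htb : TotallyBounded A := (isCompact_closedBall (0 : V) R).totallyBounded.subset hA
  obtain ⟨c, hc, hlog⟩ := exists_log_coveringNumber_le hR hA hne
  have hdom : IntervalIntegrable
      (fun r : ℝ => √(2 * R * c) * r ^ (-(1 / 2) : ℝ) + √(2 * c)) MeasureTheory.volume 0 b :=
    ((intervalIntegral.intervalIntegrable_rpow' (by norm_num)).const_mul _).add
      intervalIntegrable_const
  refine hdom.mono_fun' ?_ ?_
  · rw [Set.uIoc_of_le hb]
    exact (aemeasurable_restrict_of_antitoneOn measurableSet_Ioc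
      ((antitoneOn_sqrt_log_coveringNumber htb hne).mono fun r hr => hr.1)).aestronglyMeasurable
  · rw [Set.uIoc_of_le hb]
    filter_upwards [MeasureTheory.ae_restrict_mem measurableSet_Ioc] with r hr
    have hr0 : 0 < r := hr.1
    rw [Real.norm_of_nonneg (Real.sqrt_nonneg _)]
    have hsplit : (2 * R / r + 2) * c = 2 * R * c / r + 2 * c := by ring
    refine (Real.sqrt_le_sqrt ((hlog r hr0).trans_eq hsplit)).trans ?_
    have hle : √(2 * R * c / r + 2 * c) ≤ √(2 * R * c / r) + √(2 * c) := by
      refine Real.sqrt_le_iff.2 ⟨by positivity, ?_⟩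
      rw [add_sq, Real.sq_sqrt (by positivity), Real.sq_sqrt (by positivity)]
      have : 0 ≤ 2 * √(2 * R * c / r) * √(2 * c) := by positivity
      linarith
    refine hle.trans_eq ?_
    rw [Real.sqrt_div (by positivity), Real.rpow_neg hr0.le, ← Real.sqrt_eq_rpow, div_eq_mul_inv]

end FiniteDimensional

/-! ### Dudley's entropy integral -/

/-- On `[R / 2 ^ (j + 2), R / 2 ^ (j + 1)]` the antitone `g` is at least its value at the right end,
and the length is a quarter of `R / 2 ^ j`; hence the `4`. -/
theorem sum_mul_le_integral_of_antitoneOn {g : ℝ → ℝ} {R : ℝ} (hR : 0 < R)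
    (hg : AntitoneOn g (Set.Ioi 0)) (hg0 : ∀ r, 0 ≤ g r)
    (hint : IntervalIntegrable g MeasureTheory.volume 0 (R / 2)) (K : ℕ) :
    ∑ j ∈ Finset.range K, R / 2 ^ j * g (R / 2 ^ (j + 1)) ≤ 4 * ∫ r in (0 : ℝ)..(R / 2), g r := by
  have hanti : ∀ i j : ℕ, i ≤ j → R / 2 ^ j ≤ R / 2 ^ i := fun i j h =>
    div_le_div_of_nonneg_left hR.le (by positivity) (pow_le_pow_right₀ (by norm_num) h)
  have hsub : ∀ a b : ℝ, 0 ≤ a → a ≤ b → b ≤ R / 2 →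
      IntervalIntegrable g MeasureTheory.volume a b := fun a b ha hab hb =>
    hint.mono_set (by
      rw [Set.uIcc_of_le hab, Set.uIcc_of_le (ha.trans (hab.trans hb))]
      exact Set.Icc_subset_Icc ha hb)
  have hhalf : ∀ j : ℕ, R / 2 ^ (j + 1) ≤ R / 2 := fun j => by
    simpa using hanti 1 (j + 1) (by omega)
  have key : ∑ j ∈ Finset.range K, R / 2 ^ j * g (R / 2 ^ (j + 1)) ≤
      4 * ∫ r in (R / 2 ^ (K + 1))..(R / 2), g r := by
    induction K with
    | zero => simp
    | succ K ih =>
      have hpos : 0 < R / 2 ^ (K + 1 + 1) := by positivity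
      have hle := hanti (K + 1) (K + 1 + 1) (by omega)
      have hstep : (R / 2 ^ (K + 1) - R / 2 ^ (K + 1 + 1)) * g (R / 2 ^ (K + 1)) ≤
          ∫ r in (R / 2 ^ (K + 1 + 1))..(R / 2 ^ (K + 1)), g r := by
        rw [← smul_eq_mul, ← intervalIntegral.integral_const]
        refine intervalIntegral.integral_mono_on hle intervalIntegrable_const
          (hsub _ _ hpos.le hle (hhalf K)) fun r hr => hg (hpos.trans_le hr.1) ?_ hr.2
        exact hpos.trans_le hle
      rw [Finset.sum_range_succ, ← intervalIntegral.integral_add_adjacent_intervals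
        (hsub _ _ hpos.le hle (hhalf K))
        (hsub _ _ (hpos.le.trans hle) (hhalf K) le_rfl)]
      have h4 : R / 2 ^ K = 4 * (R / 2 ^ (K + 1) - R / 2 ^ (K + 1 + 1)) := by
        field_simp
        ring
      rw [h4]
      linarith
  refine key.trans (mul_le_mul_of_nonneg_left ?_ (by norm_num))
  have hpos : 0 < R / 2 ^ (K + 1) := by positivity
  exact intervalIntegral.integral_mono_interval hpos.le (hhalf K) le_rfl
    (Filter.Eventually.of_forall hg0) hint

/-- Dudley's entropy bound for the supremum of a Rademacher process indexed by a totally bounded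
set `A`. The chain starts from a point `x₀` that need not lie in `A`. -/
theorem expect_sSup_signedSum_le_integral {N : ℕ} {X : Type*} [PseudoMetricSpace X]
    {f : X → E N} {L : ℝ≥0} (hf : LipschitzWith L f) {A : Set X} (hA : TotallyBounded A)
    (hne : A.Nonempty) {x₀ : X} {R : ℝ} (hR : 0 < R) (hAR : A ⊆ Metric.closedBall x₀ R)
    (hint : IntervalIntegrable (fun r : ℝ => √(Real.log (coveringNumber A r)))
      MeasureTheory.volume 0 (R / 2)) :
    𝔼 ε : Fin N → ℤˣ, sSup ((fun x => signedSum ε (f x)) '' A) ≤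
      4 * √2 * L * ∫ r in (0 : ℝ)..(R / 2), √(Real.log (coveringNumber A r)) := by
  set g : ℝ → ℝ := fun r => √(Real.log (coveringNumber A r)) with hg
  have hrpos : ∀ j : ℕ, 0 < R / 2 ^ j := fun j => by positivity
  choose c hc hcard using fun j : ℕ =>
    exists_isBallCover_card_eq_coveringNumber hA (hrpos j)
  -- Level `0` is the single point `x₀`, at no entropy cost, so the first covering number used is at
  -- scale `R / 2`.
  let s : ℕ → Finset X := fun j => Nat.casesOn j {x₀} fun i => c (i + 1)
  have hs : ∀ j, (s j).Nonempty := fun j => by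
    cases j with
    | zero => exact Finset.singleton_nonempty x₀
    | succ j => exact (hc (j + 1)).nonempty hne
  have hnear : ∀ j, ∀ x ∈ A, ∃ y ∈ s j, dist x y ≤ R / 2 ^ j := fun j x hx => by
    cases j with
    | zero => exact ⟨x₀, Finset.mem_singleton_self x₀, by simpa using hAR hx⟩
    | succ j =>
      obtain ⟨y, hy, hxy⟩ := Set.mem_iUnion₂.1 ((hc (j + 1)).2 hx)
      exact ⟨y, hy, (Metric.mem_ball.1 hxy).le⟩
  have hchain : ∀ K : ℕ,
      𝔼 ε : Fin N → ℤˣ, (s K).sup' (hs K) (fun x => signedSum ε (f x - f x₀)) ≤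
        4 * √2 * L * ∫ r in (0 : ℝ)..(R / 2), g r := fun K => by
    refine (expect_sup'_chain_le hf s hs rfl (fun j => (hrpos j).le)
      (fun j x hx => hnear j x ((hc (j + 1)).1 hx)) K).trans ?_
    have hterm : ∀ j ∈ Finset.range K,
        L * (R / 2 ^ j) * √(2 * Real.log ((s (j + 1)).card : ℝ)) =
          √2 * L * (R / 2 ^ j * g (R / 2 ^ (j + 1))) := fun j _ => by
      have : (s (j + 1)).card = coveringNumber A (R / 2 ^ (j + 1)) := hcard (j + 1)
      rw [this, Real.sqrt_mul (by norm_num)]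
      ring
    rw [Finset.sum_congr rfl hterm, ← Finset.mul_sum]
    have := mul_le_mul_of_nonneg_left (sum_mul_le_integral_of_antitoneOn hR
      (antitoneOn_sqrt_log_coveringNumber hA hne) (fun _ => Real.sqrt_nonneg _) hint K)
      (show 0 ≤ √2 * (L : ℝ) by positivity)
    linarith
  -- Massart's lemma for one vector, where `log 1 = 0`, removes the starting point of the chain.
  have hmean : 𝔼 ε : Fin N → ℤˣ, signedSum ε (f x₀) ≤ 0 := by
    have := expect_sup'_signedSum_le (N := N) {()} (by simp) (fun _ => f x₀) (norm_nonneg _)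
      (fun _ _ => le_rfl)
    simpa using this
  have hbound : ∀ K : ℕ, 𝔼 ε : Fin N → ℤˣ, sSup ((fun x => signedSum ε (f x)) '' A) ≤
      4 * √2 * L * (∫ r in (0 : ℝ)..(R / 2), g r) + √(N : ℝ) * (L * (R / 2 ^ K)) := fun K => by
    -- Stopping at level `K` leaves an error controlled by Cauchy–Schwarz, which vanishes as `K →
    -- ∞`.
    have hpt : ∀ ε : Fin N → ℤˣ, sSup ((fun x => signedSum ε (f x)) '' A) ≤
        (s K).sup' (hs K) (fun x => signedSum ε (f x - f x₀)) + signedSum ε (f x₀) +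
          √(N : ℝ) * (L * (R / 2 ^ K)) := fun ε => by
      refine csSup_le (hne.image _) ?_
      rintro _ ⟨x, hx, rfl⟩
      obtain ⟨y, hy, hxy⟩ := hnear K x hx
      have h1 := Finset.le_sup' (fun x => signedSum ε (f x - f x₀)) hy
      have h2 : signedSum ε (f x - f y) ≤ √(N : ℝ) * (L * (R / 2 ^ K)) := by
        refine (signedSum_le ε _).trans (mul_le_mul_of_nonneg_left ?_ (Real.sqrt_nonneg _))
        rw [← dist_eq_norm]
        exact (hf.dist_le_mul _ _).trans (mul_le_mul_of_nonneg_left hxy L.2)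
      simp only [signedSum_sub] at h1 h2 ⊢
      linarith
    refine (Finset.expect_le_expect fun ε _ => hpt ε).trans ?_
    rw [Finset.expect_add_distrib, Finset.expect_add_distrib, Fintype.expect_const]
    linarith [hchain K]
  have hlim : Filter.Tendsto (fun K : ℕ => 4 * √2 * L * (∫ r in (0 : ℝ)..(R / 2), g r) +
      √(N : ℝ) * (L * (R / 2 ^ K))) Filter.atTop
      (nhds (4 * √2 * L * (∫ r in (0 : ℝ)..(R / 2), g r))) := by
    have h0 : Filter.Tendsto (fun K : ℕ => R / (2 : ℝ) ^ K) Filter.atTop (nhds 0) :=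
      tendsto_const_nhds.div_atTop (tendsto_pow_atTop_atTop_of_one_lt (by norm_num))
    simpa using (((h0.const_mul (L : ℝ)).const_mul √(N : ℝ)).const_add
      (4 * √2 * L * (∫ r in (0 : ℝ)..(R / 2), g r)))
  exact ge_of_tendsto' hlim hbound

/-! ### Loss vectors and network outputs -/

/-- The losses of the columns of a matrix against the targets `y`. -/
noncomputable def lossVector {n N : ℕ} (ℓ : E n → E n → ℝ) (y : Fin N → E n)
    (M : PiLp 2 (fun _ : Fin N => E n)) : E N :=
  WithLp.toLp 2 fun i => ℓ (M i) (y i)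

theorem LipschitzLoss.lipschitzWith_lossVector {n N : ℕ} {ℓ : E n → E n → ℝ} {L : ℝ≥0}
    (hℓ : LipschitzLoss ℓ L) (y : Fin N → E n) : LipschitzWith L (lossVector ℓ y) := by
  have hcoord : ∀ (M M' : PiLp 2 (fun _ : Fin N => E n)) i,
      dist (ℓ (M i) (y i)) (ℓ (M' i) (y i)) ≤ L * dist (M i) (M' i) := fun M M' i => by
    -- With the target fixed, the distance in the product is that of the first components.
    have h := hℓ.dist_le_mul (WithLp.toLp 2 (M i, y i)) (WithLp.toLp 2 (M' i, y i))
    simpa [WithLp.prod_dist_eq_of_L2, Real.sqrt_sq dist_nonneg] using h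
  refine LipschitzWith.of_dist_le_mul fun M M' => ?_
  rw [EuclideanSpace.dist_eq, PiLp.dist_eq_of_L2]
  refine Real.sqrt_le_iff.2 ⟨by positivity, ?_⟩
  rw [mul_pow, Real.sq_sqrt (Finset.sum_nonneg fun _ _ => sq_nonneg _), Finset.mul_sum]
  refine Finset.sum_le_sum fun i _ => ?_
  rw [← mul_pow]
  exact pow_le_pow_left₀ dist_nonneg (hcoord M M' i) 2

section Network
variable {pΦ pΨ k m n N : ℕ} {T : E pΨ → E k → E m → E k} {P : E pΦ → E k → E n}
  {D : Set (E m)} {CΦ CΨ CoutT Cout : ℝ}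

theorem signedMeans_lossClass (ℓ : E n → E n → ℝ) (S : Fin N → E m × E n) (ε : Fin N → ℤˣ) :
    signedMeans (lossClass ℓ (hypothesisClass T P CΦ CΨ)) S ε =
      (1 / (N : ℝ)) • ((fun M => signedSum ε (lossVector ℓ (fun i => (S i).2) M)) ''
        stackedOutputs T P CΦ CΨ (fun i => (S i).1)) := by
  ext a
  simp only [signedMeans, Set.mem_smul_set, Set.mem_image, exists_exists_and_eq_and, smul_eq_mul]
  constructor
  · rintro ⟨g, ⟨h, ⟨θ, hθ, hh⟩, hg⟩, rfl⟩
    refine ⟨WithLp.toLp 2 fun i => h (S i).1, ⟨θ, hθ, fun i => hh _⟩, ?_⟩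
    simp [signedSum, lossVector, hg]
  · rintro ⟨M, ⟨θ, hθ, hM⟩, rfl⟩
    refine ⟨fun z => ℓ (networkOutput T P θ.1 θ.2 z.1) z.2,
      ⟨networkOutput T P θ.1 θ.2, ⟨θ, hθ, fun _ => rfl⟩, fun _ => rfl⟩, ?_⟩
    simp [signedSum, lossVector, hM]

theorem rademacherComplexity_lossClass (ℓ : E n → E n → ℝ) (S : Fin N → E m × E n) :
    rademacherComplexity (lossClass ℓ (hypothesisClass T P CΦ CΨ)) S =
      1 / (N : ℝ) * 𝔼 ε : Fin N → ℤˣ,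
        sSup ((fun M => signedSum ε (lossVector ℓ (fun i => (S i).2) M)) ''
          stackedOutputs T P CΦ CΨ (fun i => (S i).1)) := by
  have hcard : (Fintype.card (Fin N → ℤˣ) : ℝ) = 2 ^ N := by simp
  simp only [rademacherComplexity, signedMeans_lossClass]
  rw [Fintype.expect_eq_sum_div_card, hcard]
  simp only [Real.sSup_smul_of_nonneg (show (0 : ℝ) ≤ 1 / N by positivity), smul_eq_mul,
    ← Finset.mul_sum]
  ring

theorem BoundedNetwork.stackedOutputs_nonempty (h : BoundedNetwork T P D CΦ CΨ CoutT Cout)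
    (d : Fin N → E m) : (stackedOutputs T P CΦ CΨ d).Nonempty :=
  ⟨WithLp.toLp 2 fun i => networkOutput T P 0 0 (d i), 0,
    ⟨by simpa using h.CΦ_pos.le, by simpa using h.CΨ_pos.le⟩, fun _ => rfl⟩

theorem BoundedNetwork.stackedOutputs_subset (h : BoundedNetwork T P D CΦ CΨ CoutT Cout)
    {d : Fin N → E m} (hd : ∀ i, d i ∈ D) :
    stackedOutputs T P CΦ CΨ d ⊆ Metric.closedBall 0 (√(N : ℝ) * Cout) := by
  rintro M ⟨θ, hθ, hM⟩
  have hC := h.Cout_pos.le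
  rw [mem_closedBall_zero_iff, PiLp.norm_eq_of_L2]
  refine Real.sqrt_le_iff.2 ⟨by positivity, ?_⟩
  rw [mul_pow, Real.sq_sqrt (Nat.cast_nonneg N)]
  calc ∑ i, ‖M i‖ ^ 2 ≤ ∑ _i : Fin N, Cout ^ 2 := by
        refine Finset.sum_le_sum fun i _ => pow_le_pow_left₀ (norm_nonneg _) ?_ 2
        rw [hM]
        exact h.norm_output_le θ hθ _ (hd i)
    _ = N * Cout ^ 2 := by simp

end Network
end ImplicitNet

open ImplicitNet
theorem mainTheorem2 {pΦ pΨ k m n N : ℕ} (hN : 0 < N)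
    (T : E pΨ → E k → E m → E k) (P : E pΦ → E k → E n) (ℓ : E n → E n → ℝ)
    (D : Set (E m)) (CΦ CΨ CoutT Cout : ℝ) (Lx Lψ LPφ LPx Lℓ : ℝ≥0)
    (hℓ : LipschitzLoss ℓ Lℓ)
    (hbdd : BoundedNetwork T P D CΦ CΨ CoutT Cout)
    (hlip : LipschitzNetwork T P D CΦ CΨ CoutT Lx Lψ LPφ LPx)
    (S : Fin N → E m × E n) (hS : ∀ i, (S i).1 ∈ D) :
    (∀ ε : Fin N → ℤˣ,
      BddAbove (signedMeans (lossClass ℓ (hypothesisClass T P CΦ CΨ)) S ε)) ∧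
    IntervalIntegrable
      (fun r : ℝ => √(Real.log
        (coveringNumber (stackedOutputs T P CΦ CΨ (fun i => (S i).1)) r)))
      MeasureTheory.volume 0 (√(N : ℝ) * Cout / 2) ∧
    rademacherComplexity (lossClass ℓ (hypothesisClass T P CΦ CΨ)) S ≤
      8 * (Lℓ : ℝ) / (N : ℝ) *
        ∫ r in (0 : ℝ)..(√(N : ℝ) * Cout / 2),
          √(Real.log (coveringNumber (stackedOutputs T P CΦ CΨ (fun i => (S i).1)) r)) := by
  have hNpos : (0 : ℝ) < N := by exact_mod_cast hN
  have hR : 0 < √(N : ℝ) * Cout := mul_pos (Real.sqrt_pos.2 hNpos) hbdd.Cout_pos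
  have hne := hbdd.stackedOutputs_nonempty (fun i => (S i).1)
  have hsub := hbdd.stackedOutputs_subset (d := fun i => (S i).1) hS
  have htb : TotallyBounded (stackedOutputs T P CΦ CΨ (fun i => (S i).1)) :=
    (isCompact_closedBall 0 (√(N : ℝ) * Cout)).totallyBounded.subset hsub
  have hf := hℓ.lipschitzWith_lossVector (fun i => (S i).2)
  have hint := intervalIntegrable_sqrt_log_coveringNumber hsub hne hR (half_pos hR).le
  refine ⟨fun ε => ?_, hint, ?_⟩
  · rw [signedMeans_lossClass]
    refine BddAbove.smul_of_nonneg ?_ (by positivity)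
    -- Compare with the zero matrix, which is within `√N * Cout` of every stacked output.
    refine ⟨signedSum ε (lossVector ℓ (fun i => (S i).2) 0) +
      √(N : ℝ) * (Lℓ * (√(N : ℝ) * Cout)), ?_⟩
    rintro _ ⟨M, hM, rfl⟩
    rw [← sub_le_iff_le_add', ← signedSum_sub]
    refine (signedSum_le ε _).trans (mul_le_mul_of_nonneg_left ?_ (Real.sqrt_nonneg _))
    rw [← dist_eq_norm]
    exact (hf.dist_le_mul _ _).trans (mul_le_mul_of_nonneg_left (hsub hM) Lℓ.2)
  · rw [rademacherComplexity_lossClass]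
    have hI : 0 ≤ ∫ r in (0 : ℝ)..(√(N : ℝ) * Cout / 2),
        √(Real.log (coveringNumber (stackedOutputs T P CΦ CΨ (fun i => (S i).1)) r)) :=
      intervalIntegral.integral_nonneg (half_pos hR).le fun _ _ => Real.sqrt_nonneg _
    have h2 : 4 * √2 ≤ 8 := by
      have : √2 ≤ 2 := Real.sqrt_le_iff.2 ⟨by norm_num, by norm_num⟩
      linarith
    rw [one_div_mul_eq_div, div_mul_eq_mul_div]
    refine div_le_div_of_nonneg_right ?_ hNpos.le
    refine (expect_sSup_signedSum_le_integral hf htb hne hR hsub hint).trans ?_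
    gcongr
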